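/- Let $n\in\mathbb N$, let $A_{-1}\in\mathbb C^{n\times n}$, and let $A_2,A_3$ be $n\times n$ matrix functions on $[-1,0]$ with entries in $L_2([-1,0],\mathbb C)$. Put $$\Delta(\lambda)=-\lambda I+\lambda e^{-\lambda}A_{-1}+\lambda\int_{-1}^0 e^{\lambda s}A_2(s)\,ds+\int_{-1}^0 e^{\lambda s}A_3(s)\,ds,\qquad \lambda\in\mathbb C,$$ let $\Delta'=\frac{d}{d\lambda}\Delta$, and let $\Delta^*(\lambda)$ be given by the same formula with $A_{-1},A_2(s),A_3(s)$ replaced by their adjoints $A_{-1}^*,A_2^*(s),A_3^*(s)$. (The roots of $\det\Delta(\lambda)=0$ are the eigenvalues of the operator associated with the delay system $\dot z(t)=A_{-1}\dot z(t-1)+\int_{-1}^0A_2(\theta)\dot z(t+\theta)\,d\theta+\int_{-1}^0A_3(\theta)z(t+\theta)\,d\theta$.) Let $\sigma_1=\{\mu_1,\dots,\mu_{\ell_1}\}$ be the set of eigenvalues of $A_{-1}$ with $|\mu|=1$, and suppose that each of them is simple (has algebraic multiplicity one). For $m=1,\dots,\ell_1$ and $k\in\mathbb Z$ let $\widetilde\lambda_m^k=\ln|\mu_m|+i(\arg\mu_m+2\pi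 k)$. Let $(r^{(k)})_{k\in\mathbb Z}$ be real numbers with $\sum_{k\in\mathbb Z}(r^{(k)})^2<\infty$, and write $\lambda_m^k$ for any root of $\det\Delta(\lambda)=0$ in the disc $|\lambda-\widetilde\lambda_m^k|\le r^{(k)}$. Then there exist constants $0<C_1<C_2$ and $N\in\mathbb N$ such that for all $m=1,\dots,\ell_1$, all $k\in\mathbb Z$ with $|k|\ge N$, all such $\lambda_m^k$, and all unit vectors $x_m^k\in\operatorname{Ker}\Delta(\lambda_m^k)$ and $y_m^k\in\operatorname{Ker}\Delta^*(\overline{\lambda_m^k})$ (Euclidean norm and inner product of $\mathbb C^n$), $$C_1\le\left|\frac1{\lambda_m^k}\left\langle\Delta'(\lambda_m^k)x_m^k,\,y_m^k\right\rangle\right|\le C_2 .$$ -/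

import Mathlib

open MeasureTheory

noncomputable section

namespace NeutralDelay

variable {n : ℕ}

/-- The characteristic matrix `Δ(z) = -z I + z e^{-z} A + z ∫_{-1}^0 e^{zs} A₂(s) ds
+ ∫_{-1}^0 e^{zs} A₃(s) ds` of the neutral delay system with neutral term `A = A₋₁`;
the integrals of matrices are taken entry by entry. -/
def charDelta (A : Matrix (Fin n) (Fin n) ℂ) (A₂ A₃ : ℝ → Matrix (Fin n) (Fin n) ℂ) (z : ℂ) :
    Matrix (Fin n) (Fin n) ℂ :=
  -(z • (1 : Matrix (Fin n) (Fin n) ℂ)) + (z * Complex.exp (-z)) • A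
    + z • Matrix.of (fun i j => ∫ s in (-1 : ℝ)..0, Complex.exp (z * (s : ℂ)) * A₂ s i j)
    + Matrix.of (fun i j => ∫ s in (-1 : ℝ)..0, Complex.exp (z * (s : ℂ)) * A₃ s i j)

/-- The matrix function `Δ*`, given by the same formula for the adjoint matrices
`A*`, `A₂(s)*`, `A₃(s)*`. -/
def charDeltaStar (A : Matrix (Fin n) (Fin n) ℂ) (A₂ A₃ : ℝ → Matrix (Fin n) (Fin n) ℂ) (z : ℂ) :
    Matrix (Fin n) (Fin n) ℂ :=
  charDelta A.conjTranspose (fun s => (A₂ s).conjTranspose) (fun s => (A₃ s).conjTranspose) z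

/-- The derivative `Δ'(z) = dΔ/dz`, entry by entry. -/
def charDeltaDeriv (A : Matrix (Fin n) (Fin n) ℂ) (A₂ A₃ : ℝ → Matrix (Fin n) (Fin n) ℂ) (z : ℂ) :
    Matrix (Fin n) (Fin n) ℂ :=
  Matrix.of (fun i j => deriv (fun w : ℂ => charDelta A A₂ A₃ w i j) z)

/-- `σ₁`, the set of the eigenvalues of `A` on the unit circle. -/
def unitSpectrum (A : Matrix (Fin n) (Fin n) ℂ) : Set ℂ :=
  {μ | μ ∈ spectrum ℂ A ∧ ‖μ‖ = 1}

/-- The unperturbed eigenvalue `ln |μ| + i (arg μ + 2πk)`. -/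
def unperturbed (μ : ℂ) (k : ℤ) : ℂ :=
  (Real.log ‖μ‖ : ℂ) + Complex.I * ((Complex.arg μ : ℂ) + 2 * (Real.pi : ℂ) * (k : ℂ))

/-- The eigenvalues of the system labelled by `μ ∈ σ₁` and `k`: the roots of `det Δ = 0` in the
disc of radius `r k` about the unperturbed eigenvalue. -/
def labelledEigenvalues (A : Matrix (Fin n) (Fin n) ℂ) (A₂ A₃ : ℝ → Matrix (Fin n) (Fin n) ℂ)
    (r : ℤ → ℝ) (μ : ℂ) (k : ℤ) : Set ℂ :=
  {z | (charDelta A A₂ A₃ z).det = 0 ∧ z ∈ Metric.closedBall (unperturbed μ k) (r k)}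

end NeutralDelay

end

open Filter Topology Complex

/-! For large `|k|` the root `z` is close to a point where `exp z = μ`, with `Re z → 0` and `|Im z|
→ ∞`. By Riemann-Lebesgue the integral terms vanish in the limit, so `Δ(z)/z → -1 + μ⁻¹ A` and
`Δ'(z)/z → -μ⁻¹ A`. For limiting kernel vectors, `x` and `y` are right and left eigenvectors of `A`
at `μ`, and the quantity becomes `-⟪y, x⟫`. It is nonzero because `μ` is simple
(`inner_ne_zero_of_rootMultiplicity_eq_one`). Compactness of the unit spheres turns this into bounds
that survive perturbation (`exists_pos_bounds_inner`), and finiteness of `σ₁` makes them uniform in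
`μ`. -/

namespace NeutralDelay

/-! ### Riemann-Lebesgue for the finite Laplace transform -/

/-- The finite Laplace transform `∫_{-1}^0 e^{zs} f(s) ds`. -/
noncomputable def laplace (f : ℝ → ℂ) (z : ℂ) : ℂ := ∫ s in (-1 : ℝ)..0, Complex.exp (z * (s : ℂ)) * f s

/-- The filter of complex numbers tending to infinity along the imaginary axis. -/
noncomputable def imagInfty : Filter ℂ := comap Complex.re (𝓝 0) ⊓ comap Complex.im (cocompact ℝ)

lemma tendsto_re_imagInfty : Tendsto Complex.re imagInfty (𝓝 0) :=
  tendsto_comap.mono_left inf_le_left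

lemma tendsto_im_imagInfty : Tendsto Complex.im imagInfty (cocompact ℝ) :=
  tendsto_comap.mono_left inf_le_right

lemma tendsto_inv_imagInfty : Tendsto (fun z : ℂ => z⁻¹) imagInfty (𝓝 0) := by
  refine tendsto_inv₀_cobounded.comp ?_
  rw [← tendsto_norm_atTop_iff_cobounded]
  have h := tendsto_norm_cocompact_atTop.comp tendsto_im_imagInfty
  exact tendsto_atTop_mono (fun z => Complex.abs_im_le_norm z) h

/-- No integrability is required: for non-integrable `f` all these integrals are 0 by convention. -/
lemma tendsto_integral_exp_imag (f : ℝ → ℂ) :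
    Tendsto (fun b : ℝ => ∫ s in (-1 : ℝ)..0, Complex.exp (I * b * s) * f s)
      (cocompact ℝ) (𝓝 0) := by
  have h := Real.tendsto_integral_exp_smul_cocompact ((Set.Ioc (-1 : ℝ) 0).indicator f)
  have hc : Tendsto (fun b : ℝ => b * (-(2 * Real.pi)⁻¹)) (cocompact ℝ) (cocompact ℝ) :=
    (Homeomorph.mulRight₀ (-(2 * Real.pi)⁻¹)
      (by simp [Real.pi_ne_zero])).isClosedEmbedding.tendsto_cocompact
  refine (h.comp hc).congr fun b => ?_
  rw [intervalIntegral.integral_of_le (by norm_num), ← integral_indicator measurableSet_Ioc]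
  refine integral_congr_ae (Eventually.of_forall fun s => ?_)
  by_cases hs : s ∈ Set.Ioc (-1 : ℝ) 0
  · simp only [hs, Set.indicator_of_mem, Circle.smul_def, Real.fourierChar_apply, smul_eq_mul]
    congr 2
    push_cast
    field_simp
  · simp [hs]

lemma intervalIntegrable_exp_mul {f : ℝ → ℂ} (hf : IntervalIntegrable f volume (-1) 0) (z : ℂ) :
    IntervalIntegrable (fun s : ℝ => Complex.exp (z * (s : ℂ)) * f s) volume (-1) 0 :=
  hf.continuousOn_mul (by fun_prop)

/-- A Riemann-Lebesgue lemma along vertical directions. -/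
lemma tendsto_laplace {f : ℝ → ℂ} (hf : IntervalIntegrable f volume (-1) 0) :
    Tendsto (laplace f) imagInfty (𝓝 0) := by
  have h1 := (tendsto_integral_exp_imag f).comp tendsto_im_imagInfty
  -- Replacing `z` by `i Im z` changes the kernel by `|exp (s Re z) - 1| ≤ 2 |Re z|` once `|Re z| ≤
  -- 1`.
  have h2 : Tendsto (fun z : ℂ => laplace f z
      - ∫ s in (-1 : ℝ)..0, Complex.exp (I * z.im * s) * f s) imagInfty (𝓝 0) := by
    have hlim : Tendsto (fun z : ℂ => (2 * |z.re|) * ∫ s in (-1 : ℝ)..0, ‖f s‖)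
        imagInfty (𝓝 0) := by
      have := ((tendsto_re_imagInfty.abs).const_mul 2).mul_const (∫ s in (-1 : ℝ)..0, ‖f s‖)
      simpa using this
    refine squeeze_zero_norm' ?_ hlim
    have hre : ∀ᶠ z in imagInfty, |z.re| ≤ 1 := by
      have := tendsto_re_imagInfty.abs
      rw [abs_zero] at this
      exact this.eventually_le_const one_pos
    filter_upwards [hre] with z hz
    rw [laplace, ← intervalIntegral.integral_sub (intervalIntegrable_exp_mul hf z)
      (intervalIntegrable_exp_mul hf _), ← intervalIntegral.integral_const_mul]
    refine intervalIntegral.norm_integral_le_of_norm_le (by norm_num) ?_ (hf.norm.const_mul _)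
    refine Eventually.of_forall fun s hs => ?_
    have hs1 : |s| ≤ 1 := abs_le.mpr ⟨hs.1.le, hs.2.trans zero_le_one⟩
    have hle : |z.re * s| ≤ |z.re| := by
      rw [abs_mul]
      exact mul_le_of_le_one_right (abs_nonneg _) hs1
    have key : Complex.exp (z * s) - Complex.exp (I * z.im * s)
        = Complex.exp ((z.im * s : ℝ) * I) * ((Real.exp (z.re * s) - 1 : ℝ) : ℂ) := by
      push_cast
      rw [mul_sub, mul_one, ← Complex.exp_add]
      congr 2
      · nth_rw 1 [← Complex.re_add_im z]
        ring
      · ring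
    rw [← sub_mul, norm_mul, key, norm_mul, Complex.norm_exp_ofReal_mul_I, one_mul,
      Complex.norm_real, Real.norm_eq_abs]
    gcongr
    exact (Real.abs_exp_sub_one_le (hle.trans hz)).trans (by gcongr)
  simpa using h2.add h1

lemma hasDerivAt_laplace {f : ℝ → ℂ} (hf : IntervalIntegrable f volume (-1) 0) (z : ℂ) :
    HasDerivAt (laplace f) (laplace (fun s => (s : ℂ) * f s) z) z := by
  have hf' : IntervalIntegrable (fun s : ℝ => (s : ℂ) * f s) volume (-1) 0 :=
    hf.continuousOn_mul (by fun_prop)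
  refine (intervalIntegral.hasDerivAt_integral_of_dominated_loc_of_deriv_le
    (F := fun w s => Complex.exp (w * (s : ℂ)) * f s)
    (F' := fun w s => Complex.exp (w * (s : ℂ)) * ((s : ℂ) * f s))
    (bound := fun s => Real.exp (‖z‖ + 1) * ‖(s : ℂ) * f s‖)
    (Metric.ball_mem_nhds z one_pos)
    (Eventually.of_forall fun w => ?_) (intervalIntegrable_exp_mul hf z) ?_ ?_
    (hf'.norm.const_mul _) ?_).2
  · exact (intervalIntegrable_exp_mul hf w).aestronglyMeasurable_restrict_uIoc
  · exact (intervalIntegrable_exp_mul hf' z).aestronglyMeasurable_restrict_uIoc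
  · refine Eventually.of_forall fun s hs w hw => ?_
    rw [Set.uIoc_of_le (by norm_num)] at hs
    rw [norm_mul, Complex.norm_exp]
    gcongr
    have hs1 : |s| ≤ 1 := abs_le.mpr ⟨hs.1.le, hs.2.trans zero_le_one⟩
    have hw' : ‖w‖ ≤ ‖z‖ + 1 := by
      have := norm_le_norm_add_norm_sub' w z
      rw [mem_ball_iff_norm] at hw
      linarith
    calc (w * (s : ℂ)).re ≤ ‖w * (s : ℂ)‖ := Complex.re_le_norm _
      _ = ‖w‖ * |s| := by simp
      _ ≤ ‖w‖ := mul_le_of_le_one_right (norm_nonneg _) hs1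
      _ ≤ _ := hw'
  · refine Eventually.of_forall fun s _ w _ => ?_
    have := (((hasDerivAt_id w).mul_const (s : ℂ)).cexp).mul_const (f s)
    simpa [mul_assoc] using this

/-! ### Asymptotics of `Δ` and `Δ'` -/

section CharDelta

variable {n : ℕ} {A : Matrix (Fin n) (Fin n) ℂ} {A₂ A₃ : ℝ → Matrix (Fin n) (Fin n) ℂ}

lemma charDelta_apply (z : ℂ) (i j : Fin n) :
    charDelta A A₂ A₃ z i j = -(z * (1 : Matrix (Fin n) (Fin n) ℂ) i j)
      + z * Complex.exp (-z) * A i j + z * laplace (fun s => A₂ s i j) z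
      + laplace (fun s => A₃ s i j) z := by
  simp [charDelta, laplace]

lemma charDeltaDeriv_apply
    (h₂ : ∀ i j, IntervalIntegrable (fun s => A₂ s i j) volume (-1) 0)
    (h₃ : ∀ i j, IntervalIntegrable (fun s => A₃ s i j) volume (-1) 0) (z : ℂ) (i j : Fin n) :
    charDeltaDeriv A A₂ A₃ z i j = -(1 : Matrix (Fin n) (Fin n) ℂ) i j
      + (Complex.exp (-z) - z * Complex.exp (-z)) * A i j
      + (laplace (fun s => A₂ s i j) z + z * laplace (fun s => (s : ℂ) * A₂ s i j) z)
      + laplace (fun s => (s : ℂ) * A₃ s i j) z := by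
  simp only [charDeltaDeriv, Matrix.of_apply, charDelta_apply]
  refine HasDerivAt.deriv ?_
  have hid := hasDerivAt_id z
  have he := hid.mul hid.neg.cexp
  have := (((hid.mul_const ((1 : Matrix (Fin n) (Fin n) ℂ) i j)).neg.add
    (he.mul_const (A i j))).add (hid.mul (hasDerivAt_laplace (h₂ i j) z))).add
      (hasDerivAt_laplace (h₃ i j) z)
  convert! this using 1
  simp only [id, Pi.neg_apply, one_mul]
  ring

/-- `Δ(z) / z` tends to `-1 + w A` when `z` goes to infinity along the imaginary axis with
`e^{-z}` tending to `w`. -/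
lemma tendsto_charDelta_div
    (h₂ : ∀ i j, IntervalIntegrable (fun s => A₂ s i j) volume (-1) 0)
    (h₃ : ∀ i j, IntervalIntegrable (fun s => A₃ s i j) volume (-1) 0)
    {F : Filter ℂ} {w : ℂ} (hF : F ≤ imagInfty)
    (hw : Tendsto (fun z : ℂ => Complex.exp (-z)) F (𝓝 w)) :
    Tendsto (fun z => z⁻¹ • charDelta A A₂ A₃ z) F (𝓝 (-1 + w • A)) := by
  refine tendsto_pi_nhds.mpr fun i => tendsto_pi_nhds.mpr fun j => ?_
  have hne : ∀ᶠ z in F, z ≠ (0 : ℂ) := by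
    have h0 := (tendsto_norm_cocompact_atTop.comp (tendsto_im_imagInfty.mono_left hF))
    filter_upwards [h0.eventually_gt_atTop 0] with z hz
    rintro rfl
    simp at hz
  have hlim := (((tendsto_const_nhds (x := -(1 : Matrix (Fin n) (Fin n) ℂ) i j)).add
    (hw.mul_const (A i j))).add ((tendsto_laplace (h₂ i j)).mono_left hF)).add
      ((tendsto_inv_imagInfty.mono_left hF).mul ((tendsto_laplace (h₃ i j)).mono_left hF))
  simp only [mul_zero, add_zero] at hlim
  refine Tendsto.congr' ?_ (hlim.trans (by simp))
  filter_upwards [hne] with z hz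
  rw [Matrix.smul_apply, charDelta_apply, smul_eq_mul]
  field_simp

/-- `Δ'(z) / z` tends to `-w A` when `z` goes to infinity along the imaginary axis with
`e^{-z}` tending to `w`. -/
lemma tendsto_charDeltaDeriv_div
    (h₂ : ∀ i j, IntervalIntegrable (fun s => A₂ s i j) volume (-1) 0)
    (h₃ : ∀ i j, IntervalIntegrable (fun s => A₃ s i j) volume (-1) 0)
    {F : Filter ℂ} {w : ℂ} (hF : F ≤ imagInfty)
    (hw : Tendsto (fun z : ℂ => Complex.exp (-z)) F (𝓝 w)) :
    Tendsto (fun z => z⁻¹ • charDeltaDeriv A A₂ A₃ z) F (𝓝 (-(w • A))) := by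
  refine tendsto_pi_nhds.mpr fun i => tendsto_pi_nhds.mpr fun j => ?_
  have hne : ∀ᶠ z in F, z ≠ (0 : ℂ) := by
    have h0 := (tendsto_norm_cocompact_atTop.comp (tendsto_im_imagInfty.mono_left hF))
    filter_upwards [h0.eventually_gt_atTop 0] with z hz
    rintro rfl
    simp at hz
  have hs : ∀ {f : ℝ → ℂ}, IntervalIntegrable f volume (-1) 0 →
      IntervalIntegrable (fun s : ℝ => (s : ℂ) * f s) volume (-1) 0 :=
    fun hf => hf.continuousOn_mul (by fun_prop)
  have hinv := tendsto_inv_imagInfty.mono_left hF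
  -- The terms of `Δ'` without a factor `z` are grouped under `z⁻¹` and vanish in the limit.
  have hlim := (hinv.mul ((((tendsto_const_nhds (x := -(1 : Matrix (Fin n) (Fin n) ℂ) i j)).add
    (hw.mul_const (A i j))).add ((tendsto_laplace (h₂ i j)).mono_left hF)).add
      ((tendsto_laplace (hs (h₃ i j))).mono_left hF))).add
      ((hw.mul_const (A i j)).neg.add ((tendsto_laplace (hs (h₂ i j))).mono_left hF))
  simp only [zero_mul, add_zero, zero_add] at hlim
  refine Tendsto.congr' ?_ (hlim.trans (by simp))
  filter_upwards [hne] with z hz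
  rw [Matrix.smul_apply, charDeltaDeriv_apply h₂ h₃, smul_eq_mul]
  field_simp
  ring

lemma laplace_conj (f : ℝ → ℂ) (z : ℂ) :
    laplace (fun s => star (f s)) (starRingEnd ℂ z) = star (laplace f z) := by
  simp only [laplace, Complex.star_def]
  rw [← intervalIntegral.intervalIntegral_conj]
  simp [← Complex.exp_conj]

/-- Makes `y` a kernel vector of the adjoint of `Δ(z)`. -/
lemma charDeltaStar_conj (z : ℂ) :
    charDeltaStar A A₂ A₃ (starRingEnd ℂ z) = (charDelta A A₂ A₃ z).conjTranspose := by
  ext i j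
  simp only [charDeltaStar, Matrix.conjTranspose_apply, charDelta_apply, laplace_conj]
  simp [← Complex.exp_conj, Matrix.one_apply, eq_comm, apply_ite (starRingEnd ℂ)]

end CharDelta

end NeutralDelay

/-! ### Compactness and simple eigenvalues -/

namespace NeutralDelay

open scoped InnerProductSpace

/-- Perturbation-stable lower and upper bounds for `⟪y, P x⟫` on unit vectors `x`, `y` in the
kernels of `T` and of its adjoint. -/
lemma exists_pos_bounds_inner {ι E : Type*} [NormedAddCommGroup E] [InnerProductSpace ℂ E]
    [FiniteDimensional ℂ E] {l : Filter ι} {T P : ι → E →L[ℂ] E} {T₀ P₀ : E →L[ℂ] E}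
    (hT : Tendsto T l (𝓝 T₀)) (hP : Tendsto P l (𝓝 P₀))
    (h : ∀ x y : E, x ≠ 0 → y ≠ 0 → T₀ x = 0 → ContinuousLinearMap.adjoint T₀ y = 0 →
      ⟪y, P₀ x⟫_ℂ ≠ 0) :
    ∃ c C : ℝ, 0 < c ∧ ∀ᶠ i in l, ∀ x y : E, ‖x‖ = 1 → ‖y‖ = 1 → T i x = 0 →
      ContinuousLinearMap.adjoint (T i) y = 0 → c ≤ ‖⟪y, P i x⟫_ℂ‖ ∧ ‖⟪y, P i x⟫_ℂ‖ ≤ C := by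
  let K : Set (E × E) := Metric.sphere 0 1 ×ˢ Metric.sphere 0 1
  -- `g` can vanish only at a pair of kernel vectors with zero pairing, which `h` excludes; its
  -- minimum on `K` gives `c`.
  let g : E × E → ℝ := fun p =>
    ‖⟪p.2, P₀ p.1⟫_ℂ‖ + ‖T₀ p.1‖ + ‖ContinuousLinearMap.adjoint T₀ p.2‖
  have : ProperSpace E := FiniteDimensional.proper ℂ E
  have hK : IsCompact K := (isCompact_sphere 0 1).prod (isCompact_sphere 0 1)
  have hg : Continuous g := by fun_prop
  have hpos : ∀ p ∈ K, 0 < g p := by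
    rintro ⟨x, y⟩ ⟨hx, hy⟩
    have hx0 : x ≠ 0 := ne_zero_of_mem_unit_sphere ⟨x, hx⟩
    have hy0 : y ≠ 0 := ne_zero_of_mem_unit_sphere ⟨y, hy⟩
    by_cases h1 : T₀ x = 0
    · by_cases h2 : ContinuousLinearMap.adjoint T₀ y = 0
      · have := norm_pos_iff.mpr (h x y hx0 hy0 h1 h2)
        simp only [g]
        positivity
      · have := norm_pos_iff.mpr h2
        simp only [g]
        positivity
    · have := norm_pos_iff.mpr h1
      simp only [g]
      positivity
  obtain ⟨c, hc, hcg⟩ : ∃ c > 0, ∀ p ∈ K, c ≤ g p := by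
    rcases K.eq_empty_or_nonempty with hE | hne
    · exact ⟨1, one_pos, by simp [hE]⟩
    · obtain ⟨p, hp, hmin⟩ := hK.exists_isMinOn hne hg.continuousOn
      exact ⟨g p, hpos p hp, fun q hq => hmin hq⟩
  -- Three errors of at most `c / 4` (from `T`, its adjoint and `P`) leave `c / 4` of the minimum.
  refine ⟨c / 4, ‖P₀‖ + c, by positivity, ?_⟩
  have hT' := (tendsto_iff_norm_sub_tendsto_zero.mp hT).eventually_lt_const
    (show (0 : ℝ) < c / 4 by positivity)
  have hP' := (tendsto_iff_norm_sub_tendsto_zero.mp hP).eventually_lt_const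
    (show (0 : ℝ) < c / 4 by positivity)
  filter_upwards [hT', hP'] with i hTi hPi x y hx hy hTx hTy
  have hgx := hcg (x, y) ⟨by simpa using hx, by simpa using hy⟩
  have b1 : ‖T₀ x‖ ≤ ‖T i - T₀‖ := by
    have := (T i - T₀).le_opNorm x
    simpa [hTx, hx] using this
  have b2 : ‖ContinuousLinearMap.adjoint T₀ y‖ ≤ ‖T i - T₀‖ := by
    have := (ContinuousLinearMap.adjoint (T i - T₀)).le_opNorm y
    rw [LinearIsometryEquiv.norm_map, map_sub] at this
    simpa [hTy, hy] using this
  have b3 : ‖⟪y, P i x⟫_ℂ - ⟪y, P₀ x⟫_ℂ‖ ≤ ‖P i - P₀‖ := by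
    rw [← inner_sub_right, ← sub_apply]
    refine (norm_inner_le_norm _ _).trans ?_
    simpa [hx, hy] using (P i - P₀).le_opNorm x
  have b4 : ‖⟪y, P₀ x⟫_ℂ‖ ≤ ‖P₀‖ := by
    refine (norm_inner_le_norm _ _).trans ?_
    simpa [hx, hy] using P₀.le_opNorm x
  have b5 := norm_sub_norm_le ⟪y, P i x⟫_ℂ ⟪y, P₀ x⟫_ℂ
  have b6 := norm_sub_norm_le ⟪y, P₀ x⟫_ℂ ⟪y, P i x⟫_ℂ
  rw [norm_sub_rev] at b6
  simp only [g] at hgx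
  constructor <;> linarith

/-- Right and left eigenvectors of a simple eigenvalue are not orthogonal. -/
lemma inner_ne_zero_of_rootMultiplicity_eq_one {E : Type*} [NormedAddCommGroup E]
    [InnerProductSpace ℂ E] [FiniteDimensional ℂ E] (φ : Module.End ℂ E) {μ : ℂ}
    (hμ : φ.charpoly.rootMultiplicity μ = 1) {x y : E} (hx : x ≠ 0) (hy : y ≠ 0)
    (hφx : φ x = μ • x) (hφy : ∀ v, ⟪y, φ v - μ • v⟫_ℂ = 0) : ⟪y, x⟫_ℂ ≠ 0 := by
  intro h0
  set ψ : E →ₗ[ℂ] E := φ - μ • LinearMap.id with hψ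
  have hψa : ∀ v, ψ v = φ v - μ • v := fun v => by simp [hψ]
  have hgen : Module.finrank ℂ (φ.maxGenEigenspace μ) = 1 := by
    rw [LinearMap.finrank_maxGenEigenspace_eq, hμ]
  have hmem : ∀ v, ψ (ψ v) = 0 → v ∈ φ.maxGenEigenspace μ := fun v hv => by
    rw [Module.End.mem_maxGenEigenspace]
    exact ⟨2, by simpa [pow_two, hψ] using hv⟩
  have hψx : ψ x = 0 := by rw [hψa, hφx, sub_self]
  -- A one-dimensional generalized eigenspace admits no Jordan chain of length 2.
  have hspan : ∀ v, ψ (ψ v) = 0 → ψ v = 0 := fun v hv => by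
    obtain ⟨c, hc⟩ := (finrank_eq_one_iff_of_nonzero' (⟨x, hmem x (by simp [hψx])⟩ :
      φ.maxGenEigenspace μ) (by simpa using hx)).mp hgen ⟨v, hmem v hv⟩
    have : c • x = v := congrArg Subtype.val hc
    rw [← this, map_smul, hψx, smul_zero]
  have hker : LinearMap.ker ψ ≤ ℂ ∙ x := fun v hv => by
    obtain ⟨c, hc⟩ := (finrank_eq_one_iff_of_nonzero' (⟨x, hmem x (by simp [hψx])⟩ :
      φ.maxGenEigenspace μ) (by simpa using hx)).mp hgen
      ⟨v, hmem v (by rw [LinearMap.mem_ker.mp hv, map_zero])⟩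
    exact Submodule.mem_span_singleton.mpr ⟨c, congrArg Subtype.val hc⟩
  have hle : LinearMap.range ψ ≤ (ℂ ∙ y)ᗮ := by
    rintro _ ⟨v, rfl⟩
    rw [Submodule.mem_orthogonal_singleton_iff_inner_right, hψa]
    exact hφy v
  -- As `ker ψ` is at most a line, the range fills the hyperplane `yᗮ`. If `x ⊥ y`, then `x = ψ w`
  -- would start a Jordan chain.
  have hrange : LinearMap.range ψ = (ℂ ∙ y)ᗮ := by
    refine Submodule.eq_of_le_of_finrank_le hle ?_
    have e1 := LinearMap.finrank_range_add_finrank_ker ψ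
    have e2 := Submodule.finrank_add_finrank_orthogonal (ℂ ∙ y)
    have e3 := Submodule.finrank_mono hker
    rw [finrank_span_singleton hx] at e3
    rw [finrank_span_singleton hy] at e2
    omega
  obtain ⟨w, hw⟩ : x ∈ LinearMap.range ψ := by
    rw [hrange, Submodule.mem_orthogonal_singleton_iff_inner_right]
    exact h0
  exact hx (by rw [← hw]; exact hspan w (by rw [hw, hψx]))

/-! ### Discs about the unperturbed eigenvalues -/

/-- The filter of complex numbers tending to infinity along the imaginary axis with `e^{-z}` tending
to `w`. -/
noncomputable def expFilter (w : ℂ) : Filter ℂ := imagInfty ⊓ comap (fun z : ℂ => Complex.exp (-z)) (𝓝 w)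

lemma re_unperturbed {μ : ℂ} (hμ : ‖μ‖ = 1) (k : ℤ) : (unperturbed μ k).re = 0 := by
  simp [unperturbed, hμ]

lemma im_unperturbed (μ : ℂ) (k : ℤ) :
    (unperturbed μ k).im = Complex.arg μ + 2 * Real.pi * k := by
  simp [unperturbed]

lemma exp_unperturbed {μ : ℂ} (hμ : ‖μ‖ = 1) (k : ℤ) : Complex.exp (unperturbed μ k) = μ := by
  have h : unperturbed μ k = Complex.arg μ * I + k * (2 * Real.pi * I) := by
    simp only [unperturbed, hμ, Real.log_one, Complex.ofReal_zero]
    ring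
  have h2 := Complex.norm_mul_exp_arg_mul_I μ
  rw [h, Complex.exp_add, Complex.exp_int_mul_two_pi_mul_I, mul_one]
  simpa [hμ] using h2

lemma tendsto_unperturbed_add {μ : ℂ} (hμ : ‖μ‖ = 1) {ι : Type*} {l : Filter ι} {k : ι → ℤ}
    {z : ι → ℂ} (hk : Tendsto k l cofinite)
    (hz : Tendsto (fun i => z i - unperturbed μ (k i)) l (𝓝 0)) :
    Tendsto z l (expFilter μ⁻¹) := by
  have hd : ∀ i, z i = unperturbed μ (k i) + (z i - unperturbed μ (k i)) := fun i => by ring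
  refine tendsto_inf.mpr ⟨tendsto_inf.mpr ⟨tendsto_comap_iff.mpr ?_, tendsto_comap_iff.mpr ?_⟩,
    tendsto_comap_iff.mpr ?_⟩
  · refine ((Complex.continuous_re.tendsto 0).comp hz).congr fun i => ?_
    simp [re_unperturbed hμ]
  · have hkc : Tendsto (fun i => (k i : ℝ)) l (cocompact ℝ) :=
      Int.tendsto_coe_cofinite.comp hk
    rw [← Metric.cobounded_eq_cocompact, ← tendsto_norm_atTop_iff_cobounded] at hkc ⊢
    have him : Tendsto (fun i => ‖(z i - unperturbed μ (k i)).im + Complex.arg μ‖) l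
        (𝓝 ‖(0 : ℂ).im + Complex.arg μ‖) :=
      (((Complex.continuous_im.tendsto 0).comp hz).add_const _).norm
    have hlow := (hkc.const_mul_atTop (show (0 : ℝ) < 2 * Real.pi by positivity)).atTop_add him.neg
    refine tendsto_atTop_mono (fun i => ?_) hlow
    have e : (z i).im = (2 * Real.pi * k i) + ((z i - unperturbed μ (k i)).im + Complex.arg μ) := by
      rw [Complex.sub_im, im_unperturbed]
      ring
    have := norm_sub_norm_le (2 * Real.pi * (k i : ℝ))
      (-((z i - unperturbed μ (k i)).im + Complex.arg μ))
    rw [sub_neg_eq_add, ← e, norm_neg, norm_mul, Real.norm_of_nonneg (by positivity)] at this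
    simpa [Function.comp_def, sub_eq_add_neg] using this
  · have h1 : Tendsto (fun i => μ⁻¹ * Complex.exp (-(z i - unperturbed μ (k i)))) l
        (𝓝 (μ⁻¹ * Complex.exp (-0))) := (hz.neg.cexp).const_mul _
    simp only [neg_zero, Complex.exp_zero, mul_one] at h1
    refine h1.congr fun i => ?_
    simp only [Function.comp_def]
    conv_rhs => rw [hd i, neg_add, Complex.exp_add, Complex.exp_neg, exp_unperturbed hμ]

/-- A property that holds along `expFilter μ⁻¹` holds uniformly on discs about the unperturbed
eigenvalues whose radii tend to zero. -/
lemma eventually_forall_closedBall {μ : ℂ} (hμ : ‖μ‖ = 1) {r : ℤ → ℝ}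
    (hr : Tendsto r cofinite (𝓝 0)) {p : ℂ → Prop} (hp : ∀ᶠ z in expFilter μ⁻¹, p z) :
    ∀ᶠ k in cofinite, ∀ z ∈ Metric.closedBall (unperturbed μ k) (r k), p z := by
  -- Leaving `z` free (`⊤`) within the disc makes the limit in `k` uniform in `z`.
  have hk : Tendsto Prod.fst (cofinite ×ˢ (⊤ : Filter ℂ) ⊓
      𝓟 {q : ℤ × ℂ | ‖q.2 - unperturbed μ q.1‖ ≤ r q.1}) cofinite :=
    tendsto_fst.mono_left inf_le_left
  have hz := tendsto_unperturbed_add hμ (z := Prod.snd) hk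
    (squeeze_zero_norm' (eventually_inf_principal.mpr (Eventually.of_forall fun q hq => hq))
      (hr.comp hk))
  have := eventually_inf_principal.mp (hz.eventually hp)
  rw [prod_top, eventually_comap] at this
  filter_upwards [this] with k hk z hz
  exact hk (k, z) rfl (mem_closedBall_iff_norm.mp hz)

/-! ### Bounds for a single `μ` -/

section Bounds

variable {n : ℕ} {A : Matrix (Fin n) (Fin n) ℂ} {A₂ A₃ : ℝ → Matrix (Fin n) (Fin n) ℂ}

lemma intervalIntegrable_of_memLp {f : ℝ → ℂ}
    (hf : MemLp f 2 (volume.restrict (Set.Icc (-1 : ℝ) 0))) :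
    IntervalIntegrable f volume (-1) 0 := by
  rw [intervalIntegrable_iff_integrableOn_Icc_of_le (by norm_num)]
  exact hf.integrable (by norm_num)

lemma continuous_toEuclideanCLM :
    Continuous (Matrix.toEuclideanCLM (n := Fin n) (𝕜 := ℂ)) :=
  (Matrix.toEuclideanCLM (n := Fin n) (𝕜 := ℂ)).toAlgEquiv.toLinearMap
    |>.continuous_of_finiteDimensional

lemma exists_bounds_expFilter
    (h₂ : ∀ i j, IntervalIntegrable (fun s => A₂ s i j) volume (-1) 0)
    (h₃ : ∀ i j, IntervalIntegrable (fun s => A₃ s i j) volume (-1) 0)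
    {μ : ℂ} (hμ : μ ≠ 0) (hsimple : A.charpoly.rootMultiplicity μ = 1) :
    ∃ c C : ℝ, 0 < c ∧ ∀ᶠ z in expFilter μ⁻¹,
      ∀ x ∈ LinearMap.ker (Matrix.toEuclideanLin (charDelta A A₂ A₃ z)),
      ∀ y ∈ LinearMap.ker (Matrix.toEuclideanLin (charDeltaStar A A₂ A₃ (starRingEnd ℂ z))),
        ‖x‖ = 1 → ‖y‖ = 1 →
          c ≤ ‖(1 / z) * inner ℂ y (Matrix.toEuclideanLin (charDeltaDeriv A A₂ A₃ z) x)‖ ∧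
          ‖(1 / z) * inner ℂ y (Matrix.toEuclideanLin (charDeltaDeriv A A₂ A₃ z) x)‖ ≤ C := by
  let Φ := Matrix.toEuclideanCLM (n := Fin n) (𝕜 := ℂ)
  have hF : expFilter μ⁻¹ ≤ imagInfty := inf_le_left
  have hw : Tendsto (fun z : ℂ => Complex.exp (-z)) (expFilter μ⁻¹) (𝓝 μ⁻¹) :=
    tendsto_comap.mono_left inf_le_right
  have hT := (continuous_toEuclideanCLM.tendsto _).comp
    (tendsto_charDelta_div (A := A) h₂ h₃ hF hw)
  have hP := (continuous_toEuclideanCLM.tendsto _).comp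
    (tendsto_charDeltaDeriv_div (A := A) h₂ h₃ hF hw)
  have hadj : ∀ M, ContinuousLinearMap.adjoint (Φ M) = Φ M.conjTranspose := fun M =>
    (map_star Φ M).symm
  have hchar : (Matrix.toEuclideanLin A).charpoly.rootMultiplicity μ = 1 := by
    rw [Matrix.toEuclideanLin, Matrix.toLpLin_eq_toLin, Matrix.charpoly_toLin, hsimple]
  obtain ⟨c, C, hc, hcC⟩ := exists_pos_bounds_inner hT hP (by
    intro x y hx hy hTx hTy
    have hTv : ∀ v, Φ (-1 + μ⁻¹ • A) v = μ⁻¹ • (Matrix.toEuclideanLin A v - μ • v) := fun v => by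
      have : Φ (-1 + μ⁻¹ • A) = -1 + μ⁻¹ • Φ A := by simp
      rw [this, smul_sub, inv_smul_smul₀ hμ]
      exact neg_add_eq_sub _ _
    have hAx : Matrix.toEuclideanLin A x = μ • x := by
      have := (hTv x).symm.trans hTx
      simpa [hμ, sub_eq_zero] using this
    have hne := inner_ne_zero_of_rootMultiplicity_eq_one (Matrix.toEuclideanLin A) hchar hx hy hAx
      fun v => by
        have : inner ℂ y (Φ (-1 + μ⁻¹ • A) v) = 0 := by
          rw [← ContinuousLinearMap.adjoint_inner_left, hTy, inner_zero_left]
        rw [hTv, inner_smul_right] at this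
        exact (mul_eq_zero.mp this).resolve_left (inv_ne_zero hμ)
    have hPx : Φ (-(μ⁻¹ • A)) x = -x := by
      have : Φ (-(μ⁻¹ • A)) = -(μ⁻¹ • Φ A) := by simp
      rw [this]
      change -(μ⁻¹ • Matrix.toEuclideanLin A x) = -x
      rw [hAx, inv_smul_smul₀ hμ]
    rw [hPx, inner_neg_right]
    exact neg_ne_zero.mpr hne)
  refine ⟨c, C, hc, ?_⟩
  filter_upwards [hcC] with z hz x hx y hy hx1 hy1
  have h := hz x y hx1 hy1
    (by
      have : Φ (z⁻¹ • charDelta A A₂ A₃ z) x = z⁻¹ • Matrix.toEuclideanLin (charDelta A A₂ A₃ z) x :=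
        by rw [map_smul]; rfl
      exact this.trans (by rw [LinearMap.mem_ker.mp hx, smul_zero]))
    (by
      rw [charDeltaStar_conj] at hy
      have : Φ (z⁻¹ • charDelta A A₂ A₃ z).conjTranspose y =
          star z⁻¹ • Matrix.toEuclideanLin (charDelta A A₂ A₃ z).conjTranspose y := by
        rw [Matrix.conjTranspose_smul, map_smul]; rfl
      exact (congrArg (· y) (hadj _)).trans (this.trans (by rw [LinearMap.mem_ker.mp hy, smul_zero])))
  have e : inner ℂ y (Φ (z⁻¹ • charDeltaDeriv A A₂ A₃ z) x)
      = (1 / z) * inner ℂ y (Matrix.toEuclideanLin (charDeltaDeriv A A₂ A₃ z) x) := by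
    rw [map_smul, one_div, ← inner_smul_right]; rfl
  rw [← e]
  exact h

end Bounds

end NeutralDelay

/-! ### Uniformity over `σ₁` -/

theorem mainTheorem8 (n : ℕ) (A : Matrix (Fin n) (Fin n) ℂ)
    (A₂ A₃ : ℝ → Matrix (Fin n) (Fin n) ℂ)
    (hA₂ : ∀ i j, MemLp (fun s => A₂ s i j) 2 (volume.restrict (Set.Icc (-1 : ℝ) 0)))
    (hA₃ : ∀ i j, MemLp (fun s => A₃ s i j) 2 (volume.restrict (Set.Icc (-1 : ℝ) 0)))
    (hsimple : ∀ μ ∈ NeutralDelay.unitSpectrum A, A.charpoly.rootMultiplicity μ = 1)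
    (r : ℤ → ℝ) (hr : Summable (fun k => r k ^ 2)) :
    ∃ (C₁ C₂ : ℝ) (N : ℕ), 0 < C₁ ∧ C₁ < C₂ ∧
      ∀ μ ∈ NeutralDelay.unitSpectrum A, ∀ k : ℤ, (N : ℤ) ≤ |k| →
        ∀ z ∈ NeutralDelay.labelledEigenvalues A A₂ A₃ r μ k,
          ∀ x ∈ LinearMap.ker (Matrix.toEuclideanLin (NeutralDelay.charDelta A A₂ A₃ z)),
          ∀ y ∈ LinearMap.ker (Matrix.toEuclideanLin
              (NeutralDelay.charDeltaStar A A₂ A₃ (starRingEnd ℂ z))),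
            ‖x‖ = 1 → ‖y‖ = 1 →
              C₁ ≤ ‖(1 / z) * inner ℂ y
                  (Matrix.toEuclideanLin (NeutralDelay.charDeltaDeriv A A₂ A₃ z) x)‖ ∧
              ‖(1 / z) * inner ℂ y
                  (Matrix.toEuclideanLin (NeutralDelay.charDeltaDeriv A A₂ A₃ z) x)‖ ≤ C₂ := by
  have h₂ := fun i j => NeutralDelay.intervalIntegrable_of_memLp (hA₂ i j)
  have h₃ := fun i j => NeutralDelay.intervalIntegrable_of_memLp (hA₃ i j)
  have hr0 : Tendsto r cofinite (𝓝 0) := by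
    have := hr.tendsto_cofinite_zero.sqrt
    rw [Real.sqrt_zero] at this
    refine (tendsto_zero_iff_abs_tendsto_zero _).mpr (this.congr fun k => ?_)
    exact Real.sqrt_sq_eq_abs _
  have hfin : (NeutralDelay.unitSpectrum A).Finite :=
    (Matrix.finite_spectrum A).subset fun μ hμ => hμ.1
  have hμ0 : ∀ μ ∈ NeutralDelay.unitSpectrum A, μ ≠ 0 := fun μ hμ h => by
    simpa [h] using hμ.2
  choose! c C hc hcC using fun μ (hμ : μ ∈ NeutralDelay.unitSpectrum A) =>
    NeutralDelay.exists_bounds_expFilter h₂ h₃ (hμ0 μ hμ) (hsimple μ hμ)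
  have hev := (eventually_all_finite hfin).mpr fun μ hμ =>
    NeutralDelay.eventually_forall_closedBall hμ.2 hr0 (hcC μ hμ)
  obtain ⟨N, hN⟩ : ∃ N : ℕ, ∀ k : ℤ, (N : ℤ) ≤ |k| → k ∉ _ := by
    obtain ⟨M, hM⟩ := (hev.image Int.natAbs).bddAbove
    refine ⟨M + 1, fun k hk hmem => ?_⟩
    have := hM (Set.mem_image_of_mem _ hmem)
    rw [Int.abs_eq_natAbs] at hk
    omega
  have hlow : ∃ C₁ : ℝ, 0 < C₁ ∧ ∀ μ ∈ NeutralDelay.unitSpectrum A, C₁ ≤ c μ := by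
    -- Taking `t` small and positive also covers empty `σ₁`.
    have h : ∀ᶠ t in 𝓝[>] (0 : ℝ), ∀ μ ∈ NeutralDelay.unitSpectrum A, t ≤ c μ :=
      (eventually_all_finite hfin).mpr fun μ hμ =>
        mem_nhdsWithin_of_mem_nhds (Iic_mem_nhds (hc μ hμ))
    obtain ⟨t, ht, ht0⟩ := (h.and self_mem_nhdsWithin).exists
    exact ⟨t, ht0, ht⟩
  obtain ⟨C₁, hC₁, hC₁c⟩ := hlow
  obtain ⟨C₂, hC₂⟩ := (hfin.image C).bddAbove
  -- The maximum enforces the strict inequality `C₁ < C₂`.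
  refine ⟨C₁, max C₂ (C₁ + 1), N, hC₁, lt_max_of_lt_right (lt_add_one C₁), ?_⟩
  intro μ hμ k hk z hz x hx y hy hx1 hy1
  have hb := not_not.mp (hN k hk) μ hμ z hz.2 x hx y hy hx1 hy1
  exact ⟨(hC₁c μ hμ).trans hb.1,
    hb.2.trans ((hC₂ (Set.mem_image_of_mem _ hμ)).trans (le_max_left _ _))⟩
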